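/- Let $\mathrm{FI}$ be the category whose objects are the sets $[n]=\{1,\dots,n\}$, $n\ge 0$, and whose morphisms are injections. An FI-graph is a functor $G_\bullet$ from $\mathrm{FI}$ to the category of finite simple graphs and graph homomorphisms; write $G_n$ for its value on $[n]$ and $G(f):G_m\to G_n$ for the map induced by an injection $f:[m]\hookrightarrow[n]$. For an integer $d\ge 0$, say that $G_\bullet$ is vertex-stable with stable degree $\le d$ if for every $n\ge d$ and every vertex $v\in V(G_{n+1})$ there are a vertex $w\in V(G_n)$ and an injection $f:[n]\hookrightarrow[n+1]$ with $G(f)(w)=v$. For $r\ge 0$, a walk of length $r$ in a graph $G$ is an $(r+1)$-tuple of vertices $(v_0,\dots,v_r)$ such that $\{v_i,v_{i+1}\}\in E(G)$ for all $0\le i\le r-1$; it is closed if $v_r=v_0$. Theorem. Let $G_\bullet$ be a vertex-stable FI-graph with stable degree $\le d$, and let $r\ge 0$ be fixed. Then there are polynomials $p,q\in\mathbb{Q}[X]$, with $\deg p\le (r+1)d$ and with $\deg q\le rd$ if $r\ge 1$ (respectively $\deg q\le d$ if $r=0$), such that for all sufficiently large $n$ $$|\{\text{walks of length } r \text{ in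 } G_n\}|=p(n)\quad\text{and}\quad|\{\text{closed walks of length } r\text{ in } G_n\}|=q(n).$$ -/

import Mathlib

open Filter

/-- An FI-graph: a functor from the category FI (objects `[n]`, here represented by `Fin n`, and
morphisms the injections `[m] ↪ [n]`) to the category of finite simple graphs and graph
homomorphisms, written out componentwise. -/
structure FIGraph where
  /-- The vertex set of `G_n`. -/
  V : ℕ → Type*
  /-- The vertex set of each `G_n` is finite. -/
  finite_V : ∀ n, Finite (V n)
  /-- The graph `G_n`. -/
  graph : ∀ n, SimpleGraph (V n)
  /-- The transition map `G(f) : G_m → G_n` induced by an injection `f : [m] ↪ [n]`. -/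
  map : ∀ {m n : ℕ}, (Fin m ↪ Fin n) → (graph m →g graph n)
  /-- `G(id) = id`. -/
  map_id : ∀ (n : ℕ) (v : V n), map (Function.Embedding.refl (Fin n)) v = v
  /-- `G(g ∘ f) = G(g) ∘ G(f)`. -/
  map_comp : ∀ {l m n : ℕ} (f : Fin l ↪ Fin m) (g : Fin m ↪ Fin n) (v : V l),
    map (f.trans g) v = map g (map f v)

/-- `G` is vertex-stable with stable degree `≤ d`: for all `n ≥ d`, every vertex of `G_{n+1}` is in
the image of the transition map of some injection `[n] ↪ [n+1]`. -/
def FIGraph.IsVertexStable (G : FIGraph) (d : ℕ) : Prop :=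
  ∀ n, d ≤ n → ∀ v : G.V (n + 1), ∃ (w : G.V n) (f : Fin n ↪ Fin (n + 1)), G.map f w = v

/-- The walks of length `r` in `H`: the `(r+1)`-tuples `(v_0, …, v_r)` of vertices such that
`{v_i, v_{i+1}}` is an edge for all `0 ≤ i ≤ r - 1`. -/
def walksOfLength {W : Type*} (H : SimpleGraph W) (r : ℕ) : Set (Fin (r + 1) → W) :=
  {v | ∀ i : Fin r, H.Adj (v i.castSucc) (v i.succ)}

/-- The closed walks of length `r` in `H`: the walks `(v_0, …, v_r)` with `v_r = v_0`. -/
def closedWalksOfLength {W : Type*} (H : SimpleGraph W) (r : ℕ) : Set (Fin (r + 1) → W) :=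
  {v | v ∈ walksOfLength H r ∧ v (Fin.last r) = v 0}

/-! Vertices form an FI-set generated in degree `d`, and walks and closed walks are stable subsets
of its `(r+1)`-fold power, which is again finitely generated. Stable subsets inherit finite
generation: any two injections `[d] ↪ [n]` differ by a permutation, so membership is governed by an
increasing chain of subsets of the finite set `X_d`. Counts of a finitely generated FI-set are
eventually polynomial by induction on degree. Fixing the point `0` (the shift) turns differences of
consecutive counts into a count of lower degree. The degree bound then comes from growth: `|X_n| =
O(n^d)`, and a closed walk is determined by its first `max r 1` vertices. -/

/-- An FI-set: a functor from the category FI of the sets `Fin n` and injections to finite sets. -/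
structure FISet where
  /-- The value on `[n]`. -/
  obj : ℕ → Type*
  /-- All values are finite. -/
  finite_obj : ∀ n, Finite (obj n)
  /-- The transition map of an injection. -/
  map : ∀ {m n : ℕ}, (Fin m ↪ Fin n) → obj m → obj n
  /-- Compatibility with identities. -/
  map_id : ∀ (n : ℕ) (v : obj n), map (Function.Embedding.refl (Fin n)) v = v
  /-- Compatibility with composition. -/
  map_comp : ∀ {l m n : ℕ} (f : Fin l ↪ Fin m) (g : Fin m ↪ Fin n) (v : obj l),
    map (f.trans g) v = map g (map f v)

/-! ### Extending and factoring injections. -/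

section Embeddings

theorem exists_trans_eq_of_range_subset {l m n : ℕ} (f : Fin l ↪ Fin n) (g : Fin m ↪ Fin n)
    (h : Set.range f ⊆ Set.range g) : ∃ k : Fin l ↪ Fin m, k.trans g = f := by
  choose k hk using fun i => h ⟨i, rfl⟩
  refine ⟨⟨k, fun a b hab => f.injective ?_⟩, ?_⟩
  · rw [← hk a, ← hk b, hab]
  · exact DFunLike.ext _ _ hk

/-- Injections out of `[m]` extend along any injection `[m] ↪ [n]`, if the target is not smaller
than `[n]`. -/
theorem exists_extension {m n p : ℕ} (f : Fin m ↪ Fin n) (g : Fin m ↪ Fin p) (h : n ≤ p) :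
    ∃ k : Fin n ↪ Fin p, f.trans k = g := by
  classical
  have hcard : Fintype.card {x // x ∉ Set.range f} ≤ Fintype.card {x // x ∉ Set.range g} := by
    rw [Fintype.card_subtype_compl, Fintype.card_subtype_compl]
    have h1 : Fintype.card {x // x ∈ Set.range f} = m := by
      exact (Fintype.card_congr (Equiv.ofInjective f f.injective).symm).trans (Fintype.card_fin m)
    have h2 : Fintype.card {x // x ∈ Set.range g} = m := by
      exact (Fintype.card_congr (Equiv.ofInjective g g.injective).symm).trans (Fintype.card_fin m)
    rw [h1, h2]
    simp only [Fintype.card_fin]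
    omega
  obtain ⟨e⟩ := Function.Embedding.nonempty_of_card_le hcard
  let e₁ : {x // x ∈ Set.range f} ↪ {x // x ∈ Set.range g} :=
    ((Equiv.ofInjective f f.injective).symm.trans
      (Equiv.ofInjective g g.injective)).toEmbedding
  refine ⟨⟨fun x => if hx : x ∈ Set.range f then (e₁ ⟨x, hx⟩ : Fin p) else (e ⟨x, hx⟩ : Fin p),
    ?_⟩, ?_⟩
  · intro a b hab
    by_cases ha : a ∈ Set.range f <;> by_cases hb : b ∈ Set.range f
    · simp only [ha, hb, dif_pos] at hab
      simpa using e₁.injective (Subtype.ext hab)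
    · simp only [ha, hb, dif_pos, dif_neg, not_false_eq_true] at hab
      exact absurd (hab ▸ (e₁ ⟨a, ha⟩).2) (e ⟨b, hb⟩).2
    · simp only [ha, hb, dif_pos, dif_neg, not_false_eq_true] at hab
      exact absurd (hab ▸ (e₁ ⟨b, hb⟩).2) (e ⟨a, ha⟩).2
    · simp only [ha, hb, dif_neg, not_false_eq_true] at hab
      simpa using e.injective (Subtype.ext hab)
  · ext i
    have hi : f i ∈ Set.range f := ⟨i, rfl⟩
    have : (Equiv.ofInjective f f.injective).symm ⟨f i, hi⟩ = i :=
      Equiv.ofInjective_symm_apply f.injective i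
    refine congrArg Fin.val ((dif_pos hi).trans ?_)
    simp [e₁, this]

theorem exists_embedding_superset {n c : ℕ} (s : Finset (Fin n)) (hs : s.card ≤ c) (hc : c ≤ n) :
    ∃ g : Fin c ↪ Fin n, (s : Set (Fin n)) ⊆ Set.range g := by
  obtain ⟨t, hst, -, ht⟩ := Finset.exists_subsuperset_card_eq (Finset.subset_univ s) hs
    (by simpa using hc)
  refine ⟨(t.orderEmbOfFin ht).toEmbedding, ?_⟩
  have : Set.range (t.orderEmbOfFin ht).toEmbedding = t := by simp
  rw [this]
  exact_mod_cast hst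

/-- The injection `[m + 1] ↪ [n + 1]` that fixes `0` and is `f` on the other elements. -/
def extendZero {m n : ℕ} (f : Fin m ↪ Fin n) : Fin (m + 1) ↪ Fin (n + 1) where
  toFun := Fin.cases 0 fun i => (f i).succ
  inj' := by
    intro a b
    refine Fin.cases ?_ (fun a => ?_) a <;> refine Fin.cases ?_ (fun b => ?_) b
    · simp
    · simp [(Fin.succ_ne_zero _).symm]
    · simp [Fin.succ_ne_zero]
    · simp

@[simp] theorem extendZero_zero {m n : ℕ} (f : Fin m ↪ Fin n) : extendZero f 0 = 0 := rfl

@[simp] theorem extendZero_succ {m n : ℕ} (f : Fin m ↪ Fin n) (i : Fin m) :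
    extendZero f i.succ = (f i).succ := rfl

theorem extendZero_refl (n : ℕ) :
    extendZero (Function.Embedding.refl (Fin n)) = Function.Embedding.refl _ := by
  ext i
  refine Fin.cases ?_ (fun i => ?_) i <;> simp

theorem extendZero_trans {l m n : ℕ} (f : Fin l ↪ Fin m) (g : Fin m ↪ Fin n) :
    extendZero (f.trans g) = (extendZero f).trans (extendZero g) := by
  ext i
  refine Fin.cases ?_ (fun i => ?_) i <;> simp

theorem succ_trans_extendZero {m n : ℕ} (f : Fin m ↪ Fin n) :
    (Fin.succEmb m).trans (extendZero f) = f.trans (Fin.succEmb n) := by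
  ext i
  simp

/-- Generation of the shift rests on this: only the nonzero values of `f` use up room in `[c]`,
since `0` is always available. -/
theorem exists_trans_extendZero {m n c : ℕ} (f : Fin m ↪ Fin (n + 1)) (hc : c ≤ n)
    (hf : (Finset.univ.filter fun i : Fin n => i.succ ∈ Set.range f).card ≤ c) :
    ∃ (g : Fin c ↪ Fin n) (k : Fin m ↪ Fin (c + 1)), k.trans (extendZero g) = f := by
  obtain ⟨g, hg⟩ := exists_embedding_superset _ hf hc
  refine ⟨g, exists_trans_eq_of_range_subset f _ ?_⟩
  intro x
  refine Fin.cases (fun _ => ⟨0, rfl⟩) (fun i hi => ?_) x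
  obtain ⟨j, hj⟩ := hg (show i ∈ _ by simpa using hi)
  exact ⟨j.succ, by simp [hj]⟩

theorem card_succ_mem_range_le {m n : ℕ} (f : Fin m ↪ Fin (n + 1)) :
    (Finset.univ.filter fun i : Fin n => i.succ ∈ Set.range f).card ≤ m := by
  have h : (Finset.univ.filter fun i : Fin n => i.succ ∈ Set.range f).map (Fin.succEmb n) ⊆
      Finset.univ.map f := by
    intro x hx
    obtain ⟨i, hi, rfl⟩ := Finset.mem_map.1 hx
    simpa using hi
  simpa using Finset.card_le_card h

theorem card_succ_mem_range_lt {m n : ℕ} (f : Fin m ↪ Fin (n + 1)) (h0 : 0 ∈ Set.range f) :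
    (Finset.univ.filter fun i : Fin n => i.succ ∈ Set.range f).card < m := by
  have h : (Finset.univ.filter fun i : Fin n => i.succ ∈ Set.range f).map (Fin.succEmb n) ⊂
      Finset.univ.map f := by
    refine Finset.ssubset_iff_of_subset (fun x hx => ?_) |>.2 ⟨0, ?_, ?_⟩
    · obtain ⟨i, hi, rfl⟩ := Finset.mem_map.1 hx
      simpa using hi
    · simpa using h0
    · simp [Fin.succ_ne_zero]
  simpa using Finset.card_lt_card h

end Embeddings

/-! ### Finite generation, stable subsets and the shift. -/

namespace FISet

/-- All elements of degree at least `d` come from elements of degree `d`. -/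
def GeneratedIn (X : FISet) (d : ℕ) : Prop :=
  ∀ n, d ≤ n → ∀ v : X.obj n, ∃ (w : X.obj d) (f : Fin d ↪ Fin n), X.map f w = v

/-- A family of subsets that is stable under the transition maps. -/
def IsSub (X : FISet) (Y : ∀ n, Set (X.obj n)) : Prop :=
  ∀ {m n : ℕ} (f : Fin m ↪ Fin n) (x : X.obj m), x ∈ Y m → X.map f x ∈ Y n

/-- Outside `Y`, all elements of degree at least `k` come from smaller degrees. -/
def GeneratedBelowOff (X : FISet) (Y : ∀ n, Set (X.obj n)) (k : ℕ) : Prop :=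
  ∀ n, k ≤ n → ∀ v : X.obj n, v ∉ Y n →
    ∃ m, m < n ∧ ∃ (w : X.obj m) (f : Fin m ↪ Fin n), X.map f w = v

/-- The FI-set given by a stable family of subsets. -/
def sub (X : FISet) (Y : ∀ n, Set (X.obj n)) (hY : X.IsSub Y) : FISet where
  obj n := Y n
  finite_obj n := have := X.finite_obj n; inferInstance
  map f x := ⟨X.map f x, hY f x x.2⟩
  map_id n v := Subtype.ext (X.map_id n v)
  map_comp f g v := Subtype.ext (X.map_comp f g v)

/-- The FI-set of `k`-tuples. -/
def pow (X : FISet) (k : ℕ) : FISet where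
  obj n := Fin k → X.obj n
  finite_obj n := have := X.finite_obj n; inferInstance
  map f x i := X.map f (x i)
  map_id n v := funext fun i => X.map_id n (v i)
  map_comp f g v := funext fun i => X.map_comp f g (v i)

/-- The shifted FI-set, with value `X_{n+1}` on `[n]`. -/
def shift (X : FISet) : FISet where
  obj n := X.obj (n + 1)
  finite_obj n := X.finite_obj (n + 1)
  map f := X.map (extendZero f)
  map_id n v := by rw [extendZero_refl, X.map_id]
  map_comp f g v := by rw [extendZero_trans, X.map_comp]

variable {X : FISet}

/-- Noetherianity: an element cannot newly enter `Y` under a transition map once the chain in `X_d`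
has stabilized. -/
theorem GeneratedIn.eventually_saturated {d : ℕ} (hX : X.GeneratedIn d)
    {Y : ∀ n, Set (X.obj n)} (hY : X.IsSub Y) :
    ∃ N, ∀ n, N ≤ n → ∀ {p : ℕ} (f : Fin n ↪ Fin p) (x : X.obj n),
      X.map f x ∈ Y p → x ∈ Y n := by
  have := X.finite_obj d
  let T : ℕ →o Set (X.obj d) :=
    { toFun := fun n => {w | ∃ f : Fin d ↪ Fin n, X.map f w ∈ Y n}
      monotone' := fun m n hmn w ⟨f, hf⟩ =>
        ⟨f.trans (Fin.castLEEmb hmn), by rw [X.map_comp]; exact hY _ _ hf⟩ }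
  obtain ⟨N, hN⟩ := WellFoundedGT.monotone_chain_condition T
  refine ⟨max N d, fun n hn p f x hx => ?_⟩
  obtain ⟨w, g, rfl⟩ := hX n (le_of_max_le_right hn) x
  have hnp : n ≤ p := by simpa using Fintype.card_le_of_embedding f
  have hw : w ∈ T p := ⟨g.trans f, by rwa [X.map_comp]⟩
  rw [← hN p ((le_of_max_le_left hn).trans hnp), hN n (le_of_max_le_left hn)] at hw
  obtain ⟨h, hh⟩ := hw
  -- `k` is a permutation of `[n]` carrying `h` to `g`; it moves a witness in `Y` to the given
  -- element.
  obtain ⟨k, rfl⟩ := exists_extension h g le_rfl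
  rw [X.map_comp]
  exact hY k _ hh

theorem GeneratedIn.exists_sub {d : ℕ} (hX : X.GeneratedIn d)
    {Y : ∀ n, Set (X.obj n)} (hY : X.IsSub Y) : ∃ e, (X.sub Y hY).GeneratedIn e := by
  obtain ⟨N, hN⟩ := hX.eventually_saturated hY
  refine ⟨max N d, fun n hn v => ?_⟩
  obtain ⟨w, f, hf⟩ := hX n (le_of_max_le_right hn) v.1
  obtain ⟨k, rfl⟩ := exists_extension (Fin.castLEEmb (le_max_right N d)) f hn
  rw [X.map_comp] at hf
  exact ⟨⟨_, hN _ (le_max_left N d) k _ (hf ▸ v.2)⟩, k, Subtype.ext hf⟩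

theorem GeneratedIn.pow {d : ℕ} (hX : X.GeneratedIn d) {k : ℕ} (hk : 0 < k) :
    (X.pow k).GeneratedIn (k * d) := by
  intro n hn v
  choose w f hf using fun i => hX n ((Nat.le_mul_of_pos_left d hk).trans hn) (v i)
  obtain ⟨g, hg⟩ := exists_embedding_superset
    (Finset.univ.biUnion fun i => Finset.univ.map (f i))
    (Finset.card_biUnion_le.trans (by simp)) hn
  choose h hh using fun i => exists_trans_eq_of_range_subset (f i) g
    (fun x ⟨y, hy⟩ => hg (by
      simp only [Finset.coe_biUnion, Set.mem_iUnion]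
      exact ⟨i, by simp, by simpa using ⟨y, hy⟩⟩))
  refine ⟨fun i => X.map (h i) (w i), g, funext fun i => ?_⟩
  change X.map g (X.map (h i) (w i)) = v i
  rw [← X.map_comp, hh, hf]

/-- Saturation of the diagonal in `X × X` is injectivity. -/
theorem GeneratedIn.eventually_injective {d : ℕ} (hX : X.GeneratedIn d) :
    ∃ N, ∀ n, N ≤ n → ∀ {p : ℕ} (f : Fin n ↪ Fin p), Function.Injective (X.map f) := by
  have hD : (X.pow 2).IsSub (fun _ => {v | v 0 = v 1}) := fun f x hx =>
    congrArg (X.map f) hx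
  obtain ⟨N, hN⟩ := (hX.pow two_pos).eventually_saturated hD
  exact ⟨N, fun n hn p f x y hxy => hN n hn f ![x, y] hxy⟩

theorem GeneratedIn.shift {d : ℕ} (hX : X.GeneratedIn d) : X.shift.GeneratedIn d := by
  intro n hn v
  obtain ⟨w, f, rfl⟩ := hX (n + 1) (by omega) v
  obtain ⟨g, k, rfl⟩ := exists_trans_extendZero f hn (card_succ_mem_range_le f)
  exact ⟨X.map k w, g, (X.map_comp _ _ _).symm⟩

/-- The elements of `X_{n+1}` that lie in `Y` or come from `X_n`. -/
def shiftSub (X : FISet) (Y : ∀ n, Set (X.obj n)) (n : ℕ) : Set (X.shift.obj n) :=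
  Y (n + 1) ∪ Set.range (X.map (Fin.succEmb n))

theorem IsSub.shiftSub {Y : ∀ n, Set (X.obj n)} (hY : X.IsSub Y) :
    X.shift.IsSub (X.shiftSub Y) := by
  rintro m n f x (hx | ⟨y, rfl⟩)
  · exact Or.inl (hY _ _ hx)
  · refine Or.inr ⟨X.map f y, ?_⟩
    change _ = X.map _ _
    rw [← X.map_comp, ← X.map_comp, succ_trans_extendZero]

/-- Elements outside `shiftSub` need an `f` hitting `0`. That point is free in the shift, so the
source degree drops by one. -/
theorem GeneratedBelowOff.shift {Y : ∀ n, Set (X.obj n)} {k : ℕ}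
    (h : X.GeneratedBelowOff Y (k + 1)) : X.shift.GeneratedBelowOff (X.shiftSub Y) k := by
  intro n hn v hv
  obtain ⟨m, hm, w, f, rfl⟩ := h (n + 1) (by omega) v fun hv' => hv (Or.inl hv')
  have h0 : 0 ∈ Set.range f := by
    by_contra h0
    obtain ⟨g, rfl⟩ := exists_trans_eq_of_range_subset f (Fin.succEmb n) (by
      rintro x hx
      obtain ⟨y, rfl⟩ := Fin.exists_succ_eq.2 (show x ≠ 0 from fun hx0 => h0 (hx0 ▸ hx))
      exact ⟨y, rfl⟩)
    exact hv (Or.inr ⟨X.map g w, (X.map_comp _ _ _).symm⟩)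
  have hlt := card_succ_mem_range_lt f h0
  obtain ⟨g, e, rfl⟩ := exists_trans_extendZero f (c := m - 1) (by omega) (by omega)
  exact ⟨m - 1, by omega, X.map e w, g, (X.map_comp _ _ _).symm⟩

/-- Saturation keeps the image of the complement of `Y n` outside `Y (n + 1)`, and injectivity
preserves its size. What remains is the complement of `shiftSub`. -/
theorem eventually_ncard_compl_succ {d : ℕ} (hX : X.GeneratedIn d)
    {Y : ∀ n, Set (X.obj n)} (hY : X.IsSub Y) :
    ∀ᶠ n in atTop, (Y (n + 1))ᶜ.ncard = (Y n)ᶜ.ncard + (X.shiftSub Y n)ᶜ.ncard := by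
  obtain ⟨N, hN⟩ := hX.eventually_saturated hY
  obtain ⟨M, hM⟩ := hX.eventually_injective
  filter_upwards [eventually_ge_atTop N, eventually_ge_atTop M] with n hn hm
  have := X.finite_obj (n + 1)
  have h1 : (Y (n + 1))ᶜ = X.map (Fin.succEmb n) '' (Y n)ᶜ ∪ (X.shiftSub Y n)ᶜ := by
    ext v
    constructor
    · intro hv
      by_cases hr : v ∈ Set.range (X.map (Fin.succEmb n))
      · obtain ⟨x, rfl⟩ := hr
        exact Or.inl ⟨x, fun hx => hv (hY _ _ hx), rfl⟩
      · exact Or.inr fun h => h.elim hv hr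
    · rintro (⟨x, hx, rfl⟩ | hv)
      · exact fun h => hx (hN n hn _ x h)
      · exact fun h => hv (Or.inl h)
  have h2 : Disjoint (X.map (Fin.succEmb n) '' (Y n)ᶜ) (X.shiftSub Y n)ᶜ := by
    rw [Set.disjoint_left]
    rintro _ ⟨x, -, rfl⟩ h
    exact h (Or.inr ⟨x, rfl⟩)
  rw [h1, Set.ncard_union_eq h2 (Set.toFinite _) (Set.toFinite (α := X.obj (n + 1)) _),
    Set.ncard_image_of_injective _ (hM n hm _)]
  rfl

theorem GeneratedBelowOff.eq_univ {Y : ∀ n, Set (X.obj n)} (hY : X.IsSub Y)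
    (h : X.GeneratedBelowOff Y 0) (n : ℕ) : Y n = Set.univ := by
  induction n using Nat.strong_induction_on with
  | _ n ih =>
    refine Set.eq_univ_of_forall fun v => ?_
    by_contra hv
    obtain ⟨m, hm, w, f, rfl⟩ := h n n.zero_le v hv
    exact hv (hY f w (ih m hm ▸ Set.mem_univ w))

end FISet

/-! ### Difference equations and degrees of polynomials. -/

theorem Polynomial.exists_eval_add_one_eq (q : Polynomial ℚ) :
    ∃ p : Polynomial ℚ, ∀ x : ℚ, p.eval (x + 1) = p.eval x + q.eval x := by
  induction q using Polynomial.induction_on' with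
  | add q₁ q₂ h₁ h₂ =>
    obtain ⟨p₁, h₁⟩ := h₁
    obtain ⟨p₂, h₂⟩ := h₂
    refine ⟨p₁ + p₂, fun x => ?_⟩
    simp only [Polynomial.eval_add, h₁, h₂]
    ring
  | monomial k a =>
    -- Bernoulli polynomials satisfy `B_{k+1}(x+1) - B_{k+1}(x) = (k+1) x^k`.
    refine ⟨Polynomial.C (a / (k + 1)) * Polynomial.bernoulli (k + 1), fun x => ?_⟩
    have hk : (k + 1 : ℚ) ≠ 0 := by positivity
    simp only [Polynomial.eval_mul, Polynomial.eval_C, Polynomial.eval_monomial]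
    rw [add_comm x 1, Polynomial.bernoulli_eval_one_add]
    push_cast
    field_simp

theorem exists_polynomial_of_eventually_sub (a : ℕ → ℚ) (q : Polynomial ℚ)
    (h : ∀ᶠ n in atTop, a (n + 1) = a n + q.eval (n : ℚ)) :
    ∃ p : Polynomial ℚ, ∀ᶠ n : ℕ in atTop, a n = p.eval (n : ℚ) := by
  obtain ⟨p, hp⟩ := q.exists_eval_add_one_eq
  obtain ⟨N, hN⟩ := eventually_atTop.1 h
  refine ⟨p + Polynomial.C (a N - p.eval (N : ℚ)), eventually_atTop.2 ⟨N, fun n hn => ?_⟩⟩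
  induction n, hn using Nat.le_induction with
  | base => simp
  | succ n hn ih =>
    rw [hN n hn, ih]
    simp only [Polynomial.eval_add, Polynomial.eval_C, Nat.cast_succ, hp]
    ring

theorem Polynomial.natDegree_le_of_eventually_le (p : Polynomial ℚ) (D : ℕ) (C : ℚ)
    (h : ∀ᶠ n : ℕ in atTop, |p.eval (n : ℚ)| ≤ C * (n : ℚ) ^ D) : p.natDegree ≤ D := by
  by_contra! hD
  have hdeg : (Polynomial.X ^ D : Polynomial ℚ).degree < p.degree := by
    rw [Polynomial.degree_X_pow]
    have hp : p ≠ 0 := by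
      rintro rfl
      simp at hD
    rw [Polynomial.degree_eq_natDegree hp]
    exact_mod_cast hD
  have ht := (Polynomial.abs_div_tendsto_atTop_atTop_of_degree_gt p _ hdeg
    (pow_ne_zero _ Polynomial.X_ne_zero)).comp tendsto_natCast_atTop_atTop
  obtain ⟨n, h1, h2, h3⟩ :=
    ((ht.eventually_gt_atTop C).and (h.and (eventually_gt_atTop 0))).exists
  have hn : (0 : ℚ) < (n : ℚ) ^ D := by positivity
  simp only [Function.comp_apply, Polynomial.eval_pow, Polynomial.eval_X, abs_div,
    abs_of_pos hn] at h1
  rw [lt_div_iff₀ hn] at h1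
  exact absurd h2 (not_le.2 h1)

/-! ### Eventually polynomial cardinalities. -/

namespace FISet

/-- Counting relative to `Y` makes the induction close: shifting lowers `k` while enlarging what is
discarded. -/
theorem exists_polynomial_ncard_compl (k : ℕ) : ∀ (X : FISet) (Y : ∀ n, Set (X.obj n)) (d : ℕ),
    X.GeneratedIn d → X.IsSub Y → X.GeneratedBelowOff Y k →
    ∃ p : Polynomial ℚ, ∀ᶠ n : ℕ in atTop, ((Y n)ᶜ.ncard : ℚ) = p.eval (n : ℚ) := by
  induction k with
  | zero =>
    intro X Y d _ hY h
    exact ⟨0, Eventually.of_forall fun n => by simp [h.eq_univ hY n]⟩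
  | succ k ih =>
    intro X Y d hX hY h
    obtain ⟨q, hq⟩ := ih X.shift (X.shiftSub Y) d hX.shift hY.shiftSub h.shift
    refine exists_polynomial_of_eventually_sub (fun n => ((Y n)ᶜ.ncard : ℚ)) q ?_
    filter_upwards [hq, eventually_ncard_compl_succ hX hY] with n h1 h2
    rw [← h1, h2]
    push_cast
    rfl

/-- The cardinalities of a finitely generated FI-set are eventually polynomial. -/
theorem GeneratedIn.exists_polynomial {X : FISet} {d : ℕ} (hX : X.GeneratedIn d) :
    ∃ p : Polynomial ℚ, ∀ᶠ n : ℕ in atTop, (Nat.card (X.obj n) : ℚ) = p.eval (n : ℚ) := by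
  obtain ⟨p, hp⟩ := exists_polynomial_ncard_compl (d + 1) X (fun _ => ∅) d hX
    (fun _ _ h => h) (fun n hn v _ => ⟨d, hn, hX n (by omega) v⟩)
  exact ⟨p, by simpa [Set.ncard_univ] using hp⟩

/-- An element is determined by a generator in `X_d` and an injection `[d] ↪ [n]`. -/
theorem GeneratedIn.card_le {X : FISet} {d n : ℕ} (hX : X.GeneratedIn d) (hn : d ≤ n) :
    Nat.card (X.obj n) ≤ Nat.card (X.obj d) * n ^ d := by
  have := X.finite_obj d
  choose w f hf using hX n hn
  have hinj : Function.Injective fun v =>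
      ((w v, (f v : Fin d → Fin n)) : X.obj d × (Fin d → Fin n)) := by
    intro a b hab
    obtain ⟨h1, h2⟩ := Prod.mk.inj hab
    rw [← hf a, ← hf b, h1, DFunLike.coe_injective h2]
  simpa using Nat.card_le_card_of_injective _ hinj

/-- A family of sets of `k`-tuples in a finitely generated FI-set that is stable under the
transition maps has eventually polynomial cardinalities. The degree is controlled by any `s` such
that the `n`-th set has at most `|X_n| ^ s` elements. -/
theorem GeneratedIn.exists_polynomial_tuples {X : FISet} {d k s : ℕ} (hX : X.GeneratedIn d)
    (hk : 0 < k) {Y : ∀ n, Set ((X.pow k).obj n)} (hY : (X.pow k).IsSub Y)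
    (hs : ∀ n, (Y n).ncard ≤ Nat.card (X.obj n) ^ s) :
    ∃ p : Polynomial ℚ, p.natDegree ≤ s * d ∧
      ∀ᶠ n : ℕ in atTop, ((Y n).ncard : ℚ) = p.eval (n : ℚ) := by
  obtain ⟨e, he⟩ := (hX.pow hk).exists_sub hY
  obtain ⟨p, hp⟩ := he.exists_polynomial
  refine ⟨p, p.natDegree_le_of_eventually_le _ ((Nat.card (X.obj d) : ℚ) ^ s) ?_, hp⟩
  filter_upwards [hp, eventually_ge_atTop d] with n h1 h2
  rw [← h1, Nat.abs_cast, mul_comm s d, pow_mul, ← mul_pow]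
  exact_mod_cast (hs n).trans (Nat.pow_le_pow_left (hX.card_le h2) s)

end FISet

/-! ### Application to walks. -/

namespace FIGraph

/-- The FI-set of vertices. -/
def vertices (G : FIGraph) : FISet where
  obj := G.V
  finite_obj := G.finite_V
  map f := G.map f
  map_id := G.map_id
  map_comp := G.map_comp

theorem IsVertexStable.generatedIn {G : FIGraph} {d : ℕ} (hG : G.IsVertexStable d) :
    G.vertices.GeneratedIn d := by
  intro n hn
  induction n, hn using Nat.le_induction with
  | base => exact fun v => ⟨v, Function.Embedding.refl _, G.map_id d v⟩
  | succ n hn ih =>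
    intro v
    obtain ⟨u, g, hg⟩ := hG n hn v
    obtain ⟨w, f, hf⟩ := ih u
    refine ⟨w, f.trans g, ?_⟩
    rw [G.vertices.map_comp, hf]
    exact hg

theorem isSub_walksOfLength (G : FIGraph) (r : ℕ) :
    (G.vertices.pow (r + 1)).IsSub fun n => walksOfLength (G.graph n) r :=
  fun f _ hx i => (G.map f).map_adj (hx i)

theorem isSub_closedWalksOfLength (G : FIGraph) (r : ℕ) :
    (G.vertices.pow (r + 1)).IsSub fun n => closedWalksOfLength (G.graph n) r :=
  fun f x hx => ⟨G.isSub_walksOfLength r f x hx.1, congrArg (G.map f) hx.2⟩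

end FIGraph

theorem ncard_walksOfLength_le {W : Type*} [Finite W] (H : SimpleGraph W) (r : ℕ) :
    (walksOfLength H r).ncard ≤ Nat.card W ^ (r + 1) := by
  simpa [Set.ncard_univ, Nat.card_fun] using Set.ncard_le_ncard (Set.subset_univ (walksOfLength H r))

theorem ncard_closedWalksOfLength_le {W : Type*} [Finite W] (H : SimpleGraph W) (r : ℕ) :
    (closedWalksOfLength H r).ncard ≤ Nat.card W ^ max r 1 := by
  -- Forgetting the last vertex loses nothing as it equals the first; for `r = 0` the only vertex
  -- must be kept, hence `max r 1`.
  have hinj : Set.InjOn (fun (v : Fin (r + 1) → W) (i : Fin (max r 1)) =>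
      v (Fin.castLE (by omega) i)) (closedWalksOfLength H r) := by
    intro v hv w hw h
    have key : ∀ i : Fin (r + 1), i.1 < max r 1 → v i = w i := fun i hi =>
      congrFun h ⟨i.1, hi⟩
    funext i
    rcases lt_or_ge i.1 (max r 1) with hi | hi
    · exact key i hi
    · obtain rfl : i = Fin.last r := Fin.ext (by have := i.2; simp only [Fin.val_last]; omega)
      rw [hv.2, hw.2]
      exact key 0 (by simp)
  simpa [Set.ncard_univ, Nat.card_fun] using
    Set.ncard_le_ncard_of_injOn _ (fun _ _ => Set.mem_univ _) hinj

theorem mainTheorem4 (G : FIGraph) (d : ℕ) (hG : G.IsVertexStable d) (r : ℕ) :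
    (∃ p : Polynomial ℚ, p.natDegree ≤ (r + 1) * d ∧
      ∀ᶠ n : ℕ in atTop, ((walksOfLength (G.graph n) r).ncard : ℚ) = p.eval (n : ℚ)) ∧
    (∃ q : Polynomial ℚ, q.natDegree ≤ max r 1 * d ∧
      ∀ᶠ n : ℕ in atTop, ((closedWalksOfLength (G.graph n) r).ncard : ℚ) = q.eval (n : ℚ)) := by
  have := G.finite_V
  exact ⟨hG.generatedIn.exists_polynomial_tuples r.succ_pos (G.isSub_walksOfLength r)
      fun n => ncard_walksOfLength_le (G.graph n) r,
    hG.generatedIn.exists_polynomial_tuples r.succ_pos (G.isSub_closedWalksOfLength r)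
      fun n => ncard_closedWalksOfLength_le (G.graph n) r⟩
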